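/- All rings are commutative with unit. Let $R\subseteq S$ be a ring extension, let $\overline R$ be the integral closure of $R$ in $S$, and let $[R,S]$ be the set of subrings $T$ of $S$ with $R\subseteq T\subseteq S$. The extension $R\subseteq S$ is called Prüfer if $R\subseteq T$ is a flat epimorphism of rings for every $T\in[R,S]$, and quasi-Prüfer if $\overline R\subseteq S$ is Prüfer. For a prime ideal $P$ of $R$ write $\kappa(P)=R_P/PR_P$. A ring morphism $R\to T$ is called quasi-finite if $T$ is a finite-type $R$-algebra and $\kappa(P)\otimes_R T$ is a finite-dimensional $\kappa(P)$-vector space for every prime ideal $P$ of $R$; it has finite fibers if only finitely many prime ideals of $T$ lie over each prime ideal of $R$; it has integral fiber morphisms if $\kappa(P)\to\kappa(P)\otimes_R T$ is integral for every prime ideal $P$ of $R$. Then the following statements are equivalent: 1. $R\subseteq S$ is quasi-Prüfer; 2. $R\subseteq T$ is quasi-finite for every $T\in[R,S]$ that is of finite type over $R$; 3. $R\subseteq T$ has finite fibers for every $T\in[R,S]$ that is of finite type over $R$; 4. $R\subseteq T$ has integral fiber morphisms for every $T\in[R,S]$. -/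

import Mathlib

/-- A ring extension `R ⊆ S` (an injective morphism of commutative rings) is *Prüfer* if
`R ⊆ T` is a flat epimorphism of commutative rings for every intermediate ring `R ⊆ T ⊆ S`. -/
structure IsPruferExtension (R S : Type*) [CommRing R] [CommRing S] [Algebra R S] : Prop where
  injective : Function.Injective (algebraMap R S)
  flat (T : Subalgebra R S) : Module.Flat R T
  epi (T : Subalgebra R S) : Algebra.IsEpi R T

/-- A ring extension `R ⊆ S` is *quasi-Prüfer* if `S` is a Prüfer extension of the integral
closure of `R` in `S`. -/
structure IsQuasiPruferExtension (R S : Type*) [CommRing R] [CommRing S] [Algebra R S] :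
    Prop where
  injective : Function.Injective (algebraMap R S)
  prufer : IsPruferExtension (integralClosure R S) S

/-- A morphism `R → T` of commutative rings is *quasi-finite* if it is of finite type and
`κ(P) ⊗[R] T` is a finite-dimensional `κ(P)`-vector space for every prime ideal `P` of `R`. -/
structure IsQuasiFiniteMorphism (R T : Type*) [CommRing R] [CommRing T] [Algebra R T] :
    Prop where
  finiteType : Algebra.FiniteType R T
  finite_fiber : Algebra.QuasiFinite R T

/-- `R → T` has *finite fibers* if only finitely many prime ideals of `T` lie over each prime
ideal of `R`. -/
def HasFiniteFibers (R T : Type*) [CommRing R] [CommRing T] [Algebra R T] : Prop :=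
  ∀ P : PrimeSpectrum R, {Q : PrimeSpectrum T | PrimeSpectrum.comap (algebraMap R T) Q = P}.Finite

/-- `R → T` has *integral fiber morphisms* if `κ(P) → κ(P) ⊗[R] T` is an integral ring morphism
for every prime ideal `P` of `R`. -/
def HasIntegralFiberMorphisms (R T : Type*) [CommRing R] [CommRing T] [Algebra R T] : Prop :=
  ∀ (P : Ideal R) [P.IsPrime], (algebraMap P.ResidueField (P.Fiber T)).IsIntegral

open TensorProduct

namespace Algebra

/-! For finite type algebras, quasi-finite, finite fibers and integral fibers coincide, so all
reduces to comparing quasi-Prüfer with quasi-finiteness. Let `A` be the integral closure. If `A →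
A[T]` is an epimorphism, it is injective on spectra; as `T ⊆ A[T]` and `R → A` are integral, the
fibers of `T` over `R` have no strict inclusions. Conversely, Zariski's main theorem for `A[u]`
gives, for each prime `q`, a denominator in `A` outside `q` carrying `u` into `A`; such local
denominators yield both flatness and epimorphism. -/

/-- A finite type algebra is quasi-finite if its fibers contain no strict inclusions of primes. -/
theorem QuasiFinite.of_forall_eq_of_le {R T : Type*} [CommRing R] [CommRing T] [Algebra R T]
    [FiniteType R T]
    (h : ∀ P Q : Ideal T, P.IsPrime → Q.IsPrime → P ≤ Q → P.under R = Q.under R → P = Q) :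
    QuasiFinite R T := by
  refine ⟨fun p hp ↦ ?_⟩
  rw [Module.finite_iff_isArtinianRing, isArtinianRing_iff_isNoetherianRing_krullDimLE_zero]
  refine ⟨FiniteType.isNoetherianRing p.ResidueField _, Ring.KrullDimLE.mk₀ fun I hI ↦ ?_⟩
  obtain ⟨M, hM, hIM⟩ := I.exists_le_maximal hI.ne_top
  let e := PrimeSpectrum.preimageOrderIsoFiber R T ⟨p, hp⟩
  let x : PrimeSpectrum (p.Fiber T) := ⟨I, hI⟩
  let y : PrimeSpectrum (p.Fiber T) := ⟨M, hM.isPrime⟩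
  have hxy : x ≤ y := hIM
  have hle : (e.symm x).1 ≤ (e.symm y).1 := e.symm.monotone hxy
  have heq : e.symm x = e.symm y := by
    refine Subtype.ext (PrimeSpectrum.ext (h _ _ (e.symm x).1.2 (e.symm y).1.2 hle ?_))
    exact congrArg PrimeSpectrum.asIdeal ((e.symm x).2.trans (e.symm y).2.symm)
  have : I = M := congrArg PrimeSpectrum.asIdeal (e.symm.injective heq)
  exact this ▸ hM

/-- Epimorphisms of commutative rings are injective on prime spectra. -/
theorem IsEpi.comap_injective (A U : Type*) [CommRing A] [CommRing U] [Algebra A U]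
    [Algebra.IsEpi A U] :
    Function.Injective (PrimeSpectrum.comap (algebraMap A U)) := by
  intro x y hxy
  let p := x.asIdeal.under A
  let K := x.asIdeal.ResidueField
  let L := y.asIdeal.ResidueField
  let φ : p.ResidueField →ₐ[A] K := Ideal.ResidueField.mapₐ p x.asIdeal (ofId A U) rfl
  let ψ : p.ResidueField →ₐ[A] L := Ideal.ResidueField.mapₐ p y.asIdeal (ofId A U)
    (congrArg PrimeSpectrum.asIdeal hxy)
  let : Algebra p.ResidueField K := φ.toAlgebra
  let : Algebra p.ResidueField L := ψ.toAlgebra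
  have : IsScalarTower A p.ResidueField K := .of_algebraMap_eq' φ.comp_algebraMap.symm
  have : IsScalarTower A p.ResidueField L := .of_algebraMap_eq' ψ.comp_algebraMap.symm
  -- `W` is nonzero, so both residue fields embed in it; the epimorphism forces the two maps from
  -- `U` to agree, hence their kernels too.
  let W := K ⊗[p.ResidueField] L
  let f : U →ₐ[A] W :=
    ((TensorProduct.includeLeft : K →ₐ[p.ResidueField] W).restrictScalars A).comp
      (IsScalarTower.toAlgHom A U K)
  let g : U →ₐ[A] W :=
    ((TensorProduct.includeRight : L →ₐ[p.ResidueField] W).restrictScalars A).comp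
      (IsScalarTower.toAlgHom A U L)
  have hfg : f = g := by
    ext u
    have h := (isEpi_iff_forall_one_tmul_eq A U).mp inferInstance u
    simpa using congrArg (TensorProduct.lift f g fun _ _ ↦ .all _ _) h.symm
  ext u
  rw [← Ideal.algebraMap_residueField_eq_zero, ← Ideal.algebraMap_residueField_eq_zero,
    ← map_eq_zero_iff (TensorProduct.includeLeft : K →ₐ[p.ResidueField] W) (RingHom.injective _),
    ← map_eq_zero_iff (TensorProduct.includeRight : L →ₐ[p.ResidueField] W) (RingHom.injective _)]
  exact iff_of_eq (congrArg (· = 0) (DFunLike.congr_fun hfg u))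

section Local

variable {A B : Type*} [CommRing A] [CommRing B] [Algebra A B]

/-- The annihilator of `1 ⊗ b - b ⊗ 1` in `B` lies in no maximal ideal: a denominator of `b` kills
it. -/
theorem IsEpi.of_forall_exists_smul_mem_range
    (h : ∀ (q : Ideal B) [q.IsPrime] (b : B),
      ∃ r : A, algebraMap A B r ∉ q ∧ r • b ∈ (algebraMap A B).range) :
    Algebra.IsEpi A B := by
  refine (isEpi_iff_forall_one_tmul_eq A B).mpr fun b ↦ ?_
  let I : Ideal B :=
    (Submodule.span (B ⊗[A] B) {(1 ⊗ₜ[A] b - b ⊗ₜ[A] 1 : B ⊗[A] B)}).annihilator.comap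
      (TensorProduct.includeLeftRingHom : B →+* B ⊗[A] B)
  have hI : I = ⊤ := by
    by_contra hI
    obtain ⟨q, hq, hIq⟩ := I.exists_le_maximal hI
    have := hq.isPrime
    obtain ⟨r, hr, a, ha⟩ := h q b
    refine hr (hIq ?_)
    simp only [I, Ideal.mem_comap, Submodule.mem_annihilator_span_singleton,
      TensorProduct.includeLeftRingHom_apply, smul_eq_mul, mul_sub, TensorProduct.tmul_mul_tmul,
      mul_one, one_mul, algebraMap_eq_smul_one]
    rw [TensorProduct.smul_tmul, ← ha, smul_mul_assoc, one_mul, ← ha, algebraMap_eq_smul_one,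
      TensorProduct.smul_tmul, sub_self]
  have := (Ideal.eq_top_iff_one I).mp hI
  rw [Ideal.mem_comap, map_one, Submodule.mem_annihilator_span_singleton, one_smul] at this
  exact sub_eq_zero.mp this

/-- A fraction `b / v` can be rewritten over `A` by clearing the denominators of both `b` and `v`.
-/
theorem isLocalization_atPrime_of_forall_exists_smul_mem_range
    (hinj : Function.Injective (algebraMap A B)) (q : Ideal B) [q.IsPrime]
    (h : ∀ b : B, ∃ r : A, algebraMap A B r ∉ q ∧ r • b ∈ (algebraMap A B).range) :
    IsLocalization.AtPrime (Localization.AtPrime q) (q.under A) where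
  map_units a := by
    rw [IsScalarTower.algebraMap_apply A B]
    exact IsLocalization.map_units (Localization.AtPrime q)
      (⟨algebraMap A B a, a.2⟩ : q.primeCompl)
  surj z := by
    obtain ⟨⟨b, v⟩, hz⟩ := IsLocalization.surj q.primeCompl z
    obtain ⟨r, hr, a, ha⟩ := h b
    obtain ⟨s, hs, c, hc⟩ := h v
    have hcq : algebraMap A B (r * c) ∉ q := by
      rw [map_mul, hc, smul_def]
      exact q.primeCompl.mul_mem hr (q.primeCompl.mul_mem hs v.2)
    refine ⟨⟨s * a, ⟨r * c, hcq⟩⟩, ?_⟩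
    simp only [IsScalarTower.algebraMap_apply A B (Localization.AtPrime q), map_mul, ha, hc,
      smul_def, ← hz]
    ring
  exists_of_eq {a b} hab := by
    rw [IsScalarTower.algebraMap_apply A B, IsScalarTower.algebraMap_apply A B _ b] at hab
    obtain ⟨v, hv⟩ := IsLocalization.exists_of_eq (M := q.primeCompl) hab
    obtain ⟨s, hs, c, hc⟩ := h v
    have hcq : algebraMap A B c ∉ q := by
      rw [hc, smul_def]
      exact q.primeCompl.mul_mem hs v.2
    refine ⟨⟨c, hcq⟩, hinj ?_⟩
    simp only [map_mul, hc, smul_def, mul_assoc, hv]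

theorem _root_.Module.Flat.of_forall_exists_smul_mem_range
    (hinj : Function.Injective (algebraMap A B))
    (h : ∀ (q : Ideal B) [q.IsPrime] (b : B),
      ∃ r : A, algebraMap A B r ∉ q ∧ r • b ∈ (algebraMap A B).range) :
    Module.Flat A B := by
  refine Module.flat_of_isLocalized_maximal (R := A) B B (fun P _ ↦ Localization.AtPrime P)
    (fun P _ ↦ Algebra.linearMap B (Localization.AtPrime P)) fun P _ ↦ ?_
  have := isLocalization_atPrime_of_forall_exists_smul_mem_range hinj P (h P)
  exact IsLocalization.flat _ (P.under A).primeCompl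

end Local

section Subalgebra

variable {R S : Type*} [CommRing R] [CommRing S] [Algebra R S]

/-- A consequence of Zariski's main theorem: a subextension of an integrally closed extension is
locally a localization as soon as its simple subextensions are quasi-finite. -/
theorem exists_smul_mem_range_of_quasiFinite_adjoin
    (hcl : ∀ s : S, IsIntegral R s → s ∈ (algebraMap R S).range)
    (U : Subalgebra R S) (q : Ideal U) [q.IsPrime] (u : U)
    [QuasiFinite R (adjoin R {(u : S)})] :
    ∃ r : R, algebraMap R U r ∉ q ∧ r • u ∈ (algebraMap R U).range := by
  have hle : adjoin R {(u : S)} ≤ U := adjoin_le (by simp)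
  let i := Subalgebra.inclusion hle
  let p : Ideal (adjoin R {(u : S)}) := q.comap i
  have : FiniteType R (adjoin R {(u : S)}) :=
    (Subalgebra.fg_iff_finiteType _).mp ⟨{(u : S)}, by simp⟩
  obtain ⟨r, hrp, hr, hm⟩ := zariskisMainProperty_iff.mp
    (ZariskisMainProperty.of_finiteType (R := R) p)
  have hval {x : adjoin R {(u : S)}} (hx : IsIntegral R x) : ∃ a : R, algebraMap R S a = x :=
    hcl _ (hx.map (Subalgebra.val _))
  obtain ⟨a, ha⟩ := hval hr
  obtain ⟨m, hm⟩ := hm ⟨u, subset_adjoin rfl⟩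
  obtain ⟨c, hc⟩ := hval hm
  -- Both `r` and `r ^ m * u` are integral over `R`, so `hcl` places them in `R`, as `a` and `c`.
  refine ⟨a ^ m, fun hq ↦ hrp ?_, c, Subtype.ext ?_⟩
  · have : algebraMap R U a = i r := Subtype.ext ha
    rw [map_pow, this] at hq
    exact Ideal.IsPrime.mem_of_pow_mem (I := q) ‹_› _ hq
  · simpa [smul_def, ha] using hc

variable {A : Type*} [CommRing A] [Algebra R A] [Algebra A S] [IsScalarTower R A S]

theorem QuasiFinite.adjoin_of_isScalarTower (s : Set S) [QuasiFinite R (adjoin R s)] :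
    QuasiFinite A (adjoin A s) := by
  have hle : adjoin R s ≤ (adjoin A s).restrictScalars R := adjoin_le subset_adjoin
  let j : adjoin R s →ₐ[R] adjoin A s := Subalgebra.inclusion hle
  let f : A ⊗[R] adjoin R s →ₐ[A] adjoin A s :=
    TensorProduct.lift (ofId A _) j fun _ _ ↦ .all _ _
  refine .of_surjective_algHom f ?_
  have : adjoin A s ≤ ((adjoin A s).val.comp f).range := by
    refine adjoin_le fun x hx ↦ ⟨1 ⊗ₜ ⟨x, subset_adjoin hx⟩, ?_⟩
    have hf : f (1 ⊗ₜ ⟨x, subset_adjoin hx⟩) = j ⟨x, subset_adjoin hx⟩ := by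
      rw [TensorProduct.lift_tmul, map_one, one_mul]
    exact congrArg Subtype.val hf
  intro y
  obtain ⟨x, hx⟩ := this y.2
  exact ⟨x, Subtype.ext hx⟩

theorem QuasiFinite.of_isEpi_adjoin [Algebra.IsIntegral R A] (T : Subalgebra R S) [FiniteType R T]
    [Algebra.IsEpi A (adjoin A (T : Set S))] : QuasiFinite R T := by
  let U := adjoin A (T : Set S)
  have hle : T ≤ U.restrictScalars R := subset_adjoin
  let j : T →ₐ[R] U := Subalgebra.inclusion hle
  let : Algebra T U := j.toAlgebra
  have : IsScalarTower R T U := .of_algebraMap_eq' j.comp_algebraMap.symm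
  have : IsScalarTower T U S := .of_algebraMap_eq' rfl
  have : Algebra.IsIntegral T U := by
    refine ⟨fun x ↦ ?_⟩
    rw [← isIntegral_algebraMap_iff (B := S) Subtype.val_injective]
    refine adjoin_induction (p := fun x _ ↦ IsIntegral T x) ?_ ?_ ?_ ?_ x.2
    · exact fun t ht ↦ isIntegral_algebraMap (x := (⟨t, ht⟩ : T))
    · exact fun a ↦ ((IsIntegral.isIntegral (R := R) a).map (IsScalarTower.toAlgHom R A S)).tower_top
    · exact fun _ _ _ _ ↦ .add
    · exact fun _ _ _ _ ↦ .mul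
  refine .of_forall_eq_of_le fun P Q hP hQ hPQ h ↦ ?_
  obtain ⟨P', -, hP', rfl⟩ := Ideal.exists_ideal_over_prime_of_isIntegral (S := U) P ⊥ (by
    have : Function.Injective (algebraMap T U) := Subalgebra.inclusion_injective hle
    rw [← RingHom.ker_eq_comap_bot, (RingHom.injective_iff_ker_eq_bot _).mp this]
    exact bot_le)
  obtain ⟨Q', hPQ', hQ', rfl⟩ := Ideal.exists_ideal_over_prime_of_isIntegral_of_isPrime Q P' hPQ
  -- Both primes contract to the same prime of `R`, so incomparability for `R → A` applies.
  have hA : P'.under A = Q'.under A := by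
    by_contra hne
    refine (Ideal.IsIntegral.comap_lt_comap (R := R)
      (lt_of_le_of_ne (Ideal.comap_mono hPQ') hne)).ne ?_
    have := IsScalarTower.algebraMap_eq R T U
    have := IsScalarTower.algebraMap_eq R A U
    simp_all [Ideal.under, Ideal.comap_comap]
  obtain rfl : P' = Q' := congrArg PrimeSpectrum.asIdeal <|
    IsEpi.comap_injective A U (a₁ := ⟨P', hP'⟩) (a₂ := ⟨Q', hQ'⟩) (PrimeSpectrum.ext hA)
  rfl

end Subalgebra

end Algebra

section

variable {R S : Type*} [CommRing R] [CommRing S] [Algebra R S]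

/-- Integrality is checked on pure tensors `k ⊗ t`, which come from the finite fiber of `R[t]`. -/
theorem hasIntegralFiberMorphisms_of_quasiFinite (T : Subalgebra R S)
    (h : ∀ T' ≤ T, Algebra.FiniteType R T' → Algebra.QuasiFinite R T') :
    HasIntegralFiberMorphisms R T := by
  intro P _ x
  induction x using TensorProduct.induction_on with
  | zero => exact RingHom.isIntegralElem_zero _
  | add x y hx hy => exact RingHom.IsIntegralElem.add _ hx hy
  | tmul k t =>
    have hle : Algebra.adjoin R {(t : S)} ≤ T := Algebra.adjoin_le (by simp)
    have := h _ hle ((Subalgebra.fg_iff_finiteType _).mp ⟨{(t : S)}, by simp⟩)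
    let f : P.Fiber (Algebra.adjoin R {(t : S)}) →ₐ[P.ResidueField] P.Fiber T :=
      Algebra.TensorProduct.map (.id _ _) (Subalgebra.inclusion hle)
    have : Algebra.IsIntegral P.ResidueField (P.Fiber (Algebra.adjoin R {(t : S)})) :=
      have := Algebra.QuasiFinite.finite_fiber (R := R) (S := Algebra.adjoin R {(t : S)}) P
      .of_finite _ _
    have := (Algebra.IsIntegral.isIntegral (R := P.ResidueField)
      (k ⊗ₜ[R] ⟨t, Algebra.subset_adjoin rfl⟩ : P.Fiber (Algebra.adjoin R {(t : S)}))).map f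
    exact this

theorem HasIntegralFiberMorphisms.quasiFinite {T : Type*} [CommRing T] [Algebra R T]
    [Algebra.FiniteType R T] (h : HasIntegralFiberMorphisms R T) : Algebra.QuasiFinite R T := by
  refine ⟨fun P _ ↦ ?_⟩
  have : Algebra.IsIntegral P.ResidueField (P.Fiber T) := ⟨h P⟩
  exact Algebra.IsIntegral.finite

theorem IsQuasiPruferExtension.quasiFinite (h : IsQuasiPruferExtension R S) (T : Subalgebra R S)
    [Algebra.FiniteType R T] : Algebra.QuasiFinite R T :=
  have := h.prufer.epi (Algebra.adjoin (integralClosure R S) (T : Set S))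
  Algebra.QuasiFinite.of_isEpi_adjoin (A := integralClosure R S) T

theorem IsQuasiPruferExtension.of_quasiFinite (hRS : Function.Injective (algebraMap R S))
    (h : ∀ T : Subalgebra R S, Algebra.FiniteType R T → Algebra.QuasiFinite R T) :
    IsQuasiPruferExtension R S := by
  have key (U : Subalgebra (integralClosure R S) S) (q : Ideal U) [q.IsPrime] (u : U) :
      ∃ r : integralClosure R S, algebraMap (integralClosure R S) U r ∉ q ∧
        r • u ∈ (algebraMap (integralClosure R S) U).range := by
    have := h (Algebra.adjoin R {(u : S)})
      ((Subalgebra.fg_iff_finiteType _).mp ⟨{(u : S)}, by simp⟩)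
    have := Algebra.QuasiFinite.adjoin_of_isScalarTower (R := R)
      (A := integralClosure R S) {(u : S)}
    exact Algebra.exists_smul_mem_range_of_quasiFinite_adjoin
      (fun s hs ↦ ⟨⟨s, isIntegral_trans (R := R) s hs⟩, rfl⟩) U q u
  refine ⟨hRS, Subtype.val_injective, fun U ↦ .of_forall_exists_smul_mem_range ?_ (key U),
    fun U ↦ .of_forall_exists_smul_mem_range (key U)⟩
  exact fun a b hab ↦ Subtype.ext (congrArg (U.val : U → S) hab)

theorem isQuasiPruferExtension_iff_quasiFinite (hRS : Function.Injective (algebraMap R S)) :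
    IsQuasiPruferExtension R S ↔
      ∀ T : Subalgebra R S, Algebra.FiniteType R T → Algebra.QuasiFinite R T :=
  ⟨fun h T _ ↦ h.quasiFinite T, .of_quasiFinite hRS⟩

end

theorem theorem6p0 {R S : Type*} [CommRing R] [CommRing S] [Algebra R S]
    (hRS : Function.Injective (algebraMap R S)) :
    (IsQuasiPruferExtension R S ↔
      ∀ T : Subalgebra R S, Algebra.FiniteType R T → IsQuasiFiniteMorphism R T) ∧
    (IsQuasiPruferExtension R S ↔
      ∀ T : Subalgebra R S, Algebra.FiniteType R T → HasFiniteFibers R T) ∧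
    (IsQuasiPruferExtension R S ↔
      ∀ T : Subalgebra R S, HasIntegralFiberMorphisms R T) := by
  rw [isQuasiPruferExtension_iff_quasiFinite hRS]
  refine ⟨⟨fun h T hT ↦ ⟨hT, h T hT⟩, fun h T hT ↦ (h T hT).finite_fiber⟩,
    forall₂_congr fun T hT ↦ Algebra.QuasiFinite.iff_finite_comap_preimage_singleton,
    fun h T ↦ hasIntegralFiberMorphisms_of_quasiFinite T fun T' _ ↦ h T',
    fun h T hT ↦ (h T).quasiFinite⟩
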